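/- Let $(M,g)$ be a smooth Riemannian manifold of dimension $m$, let $\tau:T(M)\to M$ be its tangent bundle, and let $X^H, X^V$ denote the horizontal and vertical lifts of tangent vectors of $M$ to $T(M)$ with respect to the Levi-Civita connection of $g$ (in a chart, $(\partial_i)^H=\partial_{x^i}-\Gamma_{ij}^k y^j\partial_{y^k}$ and $(\partial_i)^V=\partial_{y^i}$). Let $a,b:[0,\infty)\to\mathbb{R}$ be functions with $a(t)>0$ and $a(t)+2t\,b(t)>0$ for all $t\ge 0$, and let $g_A$ be the metric on $T(M)$ given at $u\in T_pM$, with $t=\tfrac12 g_p(u,u)$, by $$g_A(X^H,Y^H)=g_p(X,Y),\quad g_A(X^H,Y^V)=0,\quad g_A(X^V,Y^V)=a(t)\,g_p(X,Y)+b(t)\,g_p(X,u)\,g_p(Y,u).$$ The Sasaki metric $g_S$ is the case $a=1$, $b=0$. For $r>0$ let $T_rM=\{v\in T(M): g(v,v)=r^2\}$, a hypersurface of $T(M)$; let $G_A$ be the metric induced on $T_1M$ by $g_A$, and $G_r$ the metric induced on $T_rM$ by $g_S$. If $r=\sqrt{a(1/2)}$ (so $r=\sqrt a$ if $a$ is constant),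 then the fibrewise scaling $F(p,u)=(p,ru)$ is an isometry of $(T_1M,G_A)$ onto $(T_rM,G_r)$: it is a diffeomorphism $T_1M\to T_rM$ and $G_r(dF\,\xi,dF\,\eta)=G_A(\xi,\eta)$ for all $\xi,\eta$ tangent to $T_1M$ at the same point. Likewise $F$ is an isometry for the rescaled metrics $\frac{1}{4a(1/2)}G_A$ on $T_1M$ and $\frac{1}{4r^2}G_r$ on $T_rM$. -/

import Mathlib

open Bundle
open scoped Manifold ContDiff

namespace TangentSphere

noncomputable section

variable {m : ℕ} {M : Type*} [TopologicalSpace M] [ChartedSpace (EuclideanSpace ℝ (Fin m)) M]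
  [IsManifold (𝓡 m) ∞ M]

/-- The total space `T(M)` of the tangent bundle of the `m`-dimensional manifold `M`. It is a smooth
manifold; its charts are the charts `(xⁱ, yⁱ)` induced by the charts `(xⁱ)` of `M`. -/
abbrev TM (m : ℕ) (M : Type*) [TopologicalSpace M] [ChartedSpace (EuclideanSpace ℝ (Fin m)) M]
    [IsManifold (𝓡 m) ∞ M] : Type _ :=
  TangentBundle (𝓡 m) M

/-- Smooth Riemannian metrics on `M`. -/
abbrev Metric (m : ℕ) (M : Type*) [TopologicalSpace M] [ChartedSpace (EuclideanSpace ℝ (Fin m)) M]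
    [IsManifold (𝓡 m) ∞ M] : Type _ :=
  ContMDiffRiemannianMetric (𝓡 m) ∞ (EuclideanSpace ℝ (Fin m))
    (fun x : M => TangentSpace (𝓡 m) x)

/-! ### The Levi-Civita connection in a chart -/

/-- The coordinate vector field `∂/∂xⁱ` of the preferred chart `φ` at `p`, at the point
`φ⁻¹(y)`. -/
def coordVec (p : M) (i : Fin m) (y : EuclideanSpace ℝ (Fin m)) :
    TangentSpace (𝓡 m) ((extChartAt (𝓡 m) p).symm y) :=
  mfderiv 𝓘(ℝ, EuclideanSpace ℝ (Fin m)) (𝓡 m) (extChartAt (𝓡 m) p).symm y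
    (EuclideanSpace.single i (1 : ℝ))

/-- The component `g_{ij}` of the metric in the preferred chart at `p`, as a function of the
coordinates. -/
def metricCoeff (g : Metric m M) (p : M) (i j : Fin m) (y : EuclideanSpace ℝ (Fin m)) : ℝ :=
  g.inner ((extChartAt (𝓡 m) p).symm y) (coordVec p i y) (coordVec p j y)

/-- The matrix `(g_{ij})` at `p`, in the preferred chart at `p`. -/
def metricMatrix (g : Metric m M) (p : M) : Matrix (Fin m) (Fin m) ℝ :=
  Matrix.of fun i j => metricCoeff g p i j (extChartAt (𝓡 m) p p)

/-- The partial derivative `∂g_{ij}/∂xˡ` at `p`, in the preferred chart at `p`. -/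
def partialMetricCoeff (g : Metric m M) (p : M) (l i j : Fin m) : ℝ :=
  fderiv ℝ (metricCoeff g p i j) (extChartAt (𝓡 m) p p) (EuclideanSpace.single l (1 : ℝ))

/-- The Christoffel symbol `Γᵏ_{ij}` of the Levi-Civita connection of `g` at `p`, in the preferred
chart at `p`. -/
def christoffel (g : Metric m M) (p : M) (k i j : Fin m) : ℝ :=
  (1 / 2) * ∑ l, (metricMatrix g p)⁻¹ k l *
    (partialMetricCoeff g p i j l + partialMetricCoeff g p j i l - partialMetricCoeff g p l i j)

/-- The bilinear map `(X, Y) ↦ Γᵏ_{ij} Xⁱ Yʲ ∂/∂xᵏ` on `T_pM`. Mathlib identifies `T_pM` with `ℝᵐ`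
through the preferred chart at `p`, so the coordinates of a tangent vector at `p` are its
components in that chart. -/
def christoffelMap (g : Metric m M) (p : M) :
    EuclideanSpace ℝ (Fin m) →ₗ[ℝ] EuclideanSpace ℝ (Fin m) →ₗ[ℝ] EuclideanSpace ℝ (Fin m) :=
  LinearMap.mk₂ ℝ
    (fun X Y => WithLp.toLp 2 fun k => ∑ i, ∑ j, christoffel g p k i j * X i * Y j)
    (by intro X X' Y; ext k; simp [mul_add, add_mul, Finset.sum_add_distrib])
    (by
      intro c X Y; ext k
      simp only [PiLp.smul_apply, smul_eq_mul, Finset.mul_sum]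
      exact Finset.sum_congr rfl fun i _ => Finset.sum_congr rfl fun j _ => by ring)
    (by intro X Y Y'; ext k; simp [mul_add, Finset.sum_add_distrib])
    (by
      intro c X Y; ext k
      simp only [PiLp.smul_apply, smul_eq_mul, Finset.mul_sum]
      exact Finset.sum_congr rfl fun i _ => Finset.sum_congr rfl fun j _ => by ring)

/-! ### Horizontal and vertical lifts

Mathlib identifies `T_uT(M)` with `ℝᵐ × ℝᵐ` through the induced chart `(xⁱ, yⁱ)` of `T(M)` at `u`,
which comes from the preferred chart of `M` at the base point of `u`: the pair `(ξ, η)` is the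
tangent vector `ξⁱ ∂/∂xⁱ + ηᵏ ∂/∂yᵏ`. -/

/-- The horizontal lift of `X` to `u`: `Xⁱ δ_i`, where
`δ_i = ∂/∂xⁱ - Γᵏ_{ij} yʲ ∂/∂yᵏ` and `yʲ` are the components of `u`. -/
def horLift (g : Metric m M) (u : TM m M) :
    TangentSpace (𝓡 m) u.proj →ₗ[ℝ] TangentSpace (𝓡 m).tangent u :=
  LinearMap.prod (LinearMap.id : EuclideanSpace ℝ (Fin m) →ₗ[ℝ] EuclideanSpace ℝ (Fin m))
    (-(christoffelMap g u.proj).flip u.snd)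

/-- The vertical lift of `X` to `u`: `Xᵏ ∂/∂yᵏ`. -/
def vertLift (u : TM m M) :
    TangentSpace (𝓡 m) u.proj →ₗ[ℝ] TangentSpace (𝓡 m).tangent u :=
  LinearMap.inr ℝ (EuclideanSpace ℝ (Fin m)) (EuclideanSpace ℝ (Fin m))

/-- The vector of `T_pM` whose horizontal lift is the horizontal part of a tangent vector of
`T(M)`: the image under the differential of the projection `τ : T(M) → M`. -/
def horPart (u : TM m M) :
    TangentSpace (𝓡 m).tangent u →ₗ[ℝ] TangentSpace (𝓡 m) u.proj :=
  LinearMap.fst ℝ (EuclideanSpace ℝ (Fin m)) (EuclideanSpace ℝ (Fin m))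

/-- The vector of `T_pM` whose vertical lift is the vertical part of a tangent vector of `T(M)`:
`K(ξⁱ ∂/∂xⁱ + ηᵏ ∂/∂yᵏ) = (ηᵏ + Γᵏ_{ij} ξⁱ yʲ) ∂/∂xᵏ`, the connection map of the Levi-Civita
connection. -/
def vertPart (g : Metric m M) (u : TM m M) :
    TangentSpace (𝓡 m).tangent u →ₗ[ℝ] TangentSpace (𝓡 m) u.proj :=
  (LinearMap.snd ℝ (EuclideanSpace ℝ (Fin m)) (EuclideanSpace ℝ (Fin m)) +
    (christoffelMap g u.proj).flip u.snd ∘ₗ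
      LinearMap.fst ℝ (EuclideanSpace ℝ (Fin m)) (EuclideanSpace ℝ (Fin m)) :
    EuclideanSpace ℝ (Fin m) × EuclideanSpace ℝ (Fin m) →ₗ[ℝ] EuclideanSpace ℝ (Fin m))

/-- `T_uT(M)` is spanned by horizontal and vertical lifts. -/
theorem horLift_add_vertLift (g : Metric m M) (u : TM m M)
    (ξ : TangentSpace (𝓡 m).tangent u) :
    horLift g u (horPart u ξ) + vertLift u (vertPart g u ξ) = ξ := by
  have key : ∀ x y z : EuclideanSpace ℝ (Fin m), ((x, -z) + (0, y + z) :
      EuclideanSpace ℝ (Fin m) × EuclideanSpace ℝ (Fin m)) = (x, y) := by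
    intro x y z
    simp
  exact key _ _ _

@[simp]
theorem horPart_horLift (g : Metric m M) (u : TM m M) (X : TangentSpace (𝓡 m) u.proj) :
    horPart u (horLift g u X) = X := rfl

@[simp]
theorem horPart_vertLift (u : TM m M) (X : TangentSpace (𝓡 m) u.proj) :
    horPart u (vertLift u X) = 0 := rfl

@[simp]
theorem vertPart_horLift (g : Metric m M) (u : TM m M) (X : TangentSpace (𝓡 m) u.proj) :
    vertPart g u (horLift g u X) = 0 := by
  have key : ∀ Z : EuclideanSpace ℝ (Fin m), -Z + Z = 0 := neg_add_cancel
  exact key _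

@[simp]
theorem vertPart_vertLift (g : Metric m M) (u : TM m M) (X : TangentSpace (𝓡 m) u.proj) :
    vertPart g u (vertLift u X) = X := by
  have key : ∀ Z V : EuclideanSpace ℝ (Fin m), Z + christoffelMap g u.proj 0 V = Z := by
    intro Z V
    simp
  exact key X u.snd

/-! ### The metrics on the tangent bundle -/

/-- The function `u ↦ g(u, u)` on `T(M)`. -/
def normSq (g : Metric m M) (u : TM m M) : ℝ :=
  g.inner u.proj u.snd u.snd

/-- The general metric `g_A` on `T(M)` with parameters `a` and `b`, as a bilinear form on each
tangent space of `T(M)`; here `t = g(u, u) / 2`. -/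
def metricA (g : Metric m M) (a b : ℝ → ℝ) (u : TM m M) :
    LinearMap.BilinForm ℝ (TangentSpace (𝓡 m).tangent u) :=
  LinearMap.mk₂ ℝ
    (fun ξ η =>
      g.inner u.proj (horPart u ξ) (horPart u η) +
        (a (normSq g u / 2) * g.inner u.proj (vertPart g u ξ) (vertPart g u η) +
          b (normSq g u / 2) * (g.inner u.proj (vertPart g u ξ) u.snd *
            g.inner u.proj (vertPart g u η) u.snd)))
    (by intro ξ ξ' η; simp only [map_add, add_apply]; ring)
    (by intro c ξ η; simp only [map_smul, smul_apply, smul_eq_mul]; ring)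
    (by intro ξ η η'; simp only [map_add, add_apply]; ring)
    (by intro c ξ η; simp only [map_smul, smul_apply, smul_eq_mul]; ring)

/-- The Sasaki metric on `T(M)`. -/
def metricS (g : Metric m M) (u : TM m M) :
    LinearMap.BilinForm ℝ (TangentSpace (𝓡 m).tangent u) :=
  metricA g (fun _ => 1) (fun _ => 0) u

theorem metricA_horLift_horLift (g : Metric m M) (a b : ℝ → ℝ) (u : TM m M)
    (X Y : TangentSpace (𝓡 m) u.proj) :
    metricA g a b u (horLift g u X) (horLift g u Y) = g.inner u.proj X Y := by
  simp [metricA]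

theorem metricA_horLift_vertLift (g : Metric m M) (a b : ℝ → ℝ) (u : TM m M)
    (X Y : TangentSpace (𝓡 m) u.proj) :
    metricA g a b u (horLift g u X) (vertLift u Y) = 0 := by
  simp [metricA]

theorem metricA_vertLift_vertLift (g : Metric m M) (a b : ℝ → ℝ) (u : TM m M)
    (X Y : TangentSpace (𝓡 m) u.proj) :
    metricA g a b u (vertLift u X) (vertLift u Y) =
      a (normSq g u / 2) * g.inner u.proj X Y +
        b (normSq g u / 2) * (g.inner u.proj X u.snd * g.inner u.proj Y u.snd) := by
  simp [metricA]

/-! ### The tangent sphere bundles -/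

/-- The tangent sphere bundle `T_rM`, a hypersurface of `T(M)`. -/
def sphereBundle (g : Metric m M) (r : ℝ) : Set (TM m M) :=
  {v | normSq g v = r ^ 2}

/-- The tangent space at `v` of the hypersurface `T_rM`, as a subspace of `T_vT(M)`: the kernel of
the differential of the defining function `v ↦ g(v, v)`, of which `r ^ 2` is a regular value when
`0 < r`. -/
def sphereTangent (g : Metric m M) (r : ℝ) (v : sphereBundle g r) :
    Submodule ℝ (TangentSpace (𝓡 m).tangent (v : TM m M)) :=
  LinearMap.ker (mfderiv (𝓡 m).tangent 𝓘(ℝ, ℝ) (normSq g) (v : TM m M)).toLinearMap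

/-- The metric induced on `T_rM` by `g_A`. -/
def inducedA (g : Metric m M) (a b : ℝ → ℝ) (r : ℝ) (v : sphereBundle g r) :
    LinearMap.BilinForm ℝ (sphereTangent g r v) :=
  (metricA g a b v).restrict (sphereTangent g r v)

/-- The metric induced on `T_rM` by the Sasaki metric. -/
def inducedS (g : Metric m M) (r : ℝ) (v : sphereBundle g r) :
    LinearMap.BilinForm ℝ (sphereTangent g r v) :=
  (metricS g v).restrict (sphereTangent g r v)

/-- Fibrewise scaling `(p, u) ↦ (p, r u)` of `T(M)`. -/
def fibreScale (r : ℝ) (u : TM m M) : TM m M :=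
  ⟨u.proj, r • u.snd⟩

/-! ### Isometries between hypersurfaces -/

/-- `Φ : T(M) → T(M)` is a smooth local extension, near the point `x` of the subset `S`, of the map
`f : S → T(M)`. -/
def IsLocalExtension (S : Set (TM m M)) (f : S → TM m M) (x : S) (Φ : TM m M → TM m M) : Prop :=
  ∃ U : Set (TM m M), IsOpen U ∧ (x : TM m M) ∈ U ∧
    ContMDiffOn (𝓡 m).tangent (𝓡 m).tangent ∞ Φ U ∧ ∀ y : S, (y : TM m M) ∈ U → Φ y = f y

/-- A map from an embedded submanifold `S` of `T(M)` to `T(M)` is smooth if locally it extends to a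
smooth map on an open subset of `T(M)`. -/
def IsSmoothMap (S : Set (TM m M)) (f : S → TM m M) : Prop :=
  ∀ x : S, ∃ Φ, IsLocalExtension S f x Φ

/-- `F : T_sM → T_rM` is an isometry of the Riemannian manifolds `(T_sM, G)` and `(T_rM, G')`: it is
a diffeomorphism, and at each `u` its differential `L`, which is the restriction of the differential
of a smooth local extension of `F`, satisfies `G'(L ξ, L η) = G(ξ, η)`. -/
structure IsIsometry (g : Metric m M) {s r : ℝ}
    (G : ∀ u : sphereBundle g s, LinearMap.BilinForm ℝ (sphereTangent g s u))
    (G' : ∀ v : sphereBundle g r, LinearMap.BilinForm ℝ (sphereTangent g r v))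
    (F : sphereBundle g s ≃ sphereBundle g r) : Prop where
  smooth : IsSmoothMap (sphereBundle g s) fun u => (F u : TM m M)
  smooth_symm : IsSmoothMap (sphereBundle g r) fun v => (F.symm v : TM m M)
  isometry : ∀ u : sphereBundle g s,
    ∃ L : sphereTangent g s u →ₗ[ℝ] sphereTangent g r (F u),
      (∃ Φ, IsLocalExtension (sphereBundle g s) (fun u => (F u : TM m M)) u Φ ∧
        ∀ ξ : sphereTangent g s u,
          tangentMap (𝓡 m).tangent (𝓡 m).tangent Φ ⟨u, ξ⟩ = ⟨F u, L ξ⟩) ∧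
      ∀ ξ η : sphereTangent g s u, G' (F u) (L ξ) (L η) = G u ξ η

end

end TangentSphere

open Filter
open scoped Topology

namespace TangentSphere

variable {m : ℕ} {M : Type*} [TopologicalSpace M] [ChartedSpace (EuclideanSpace ℝ (Fin m)) M]
  [IsManifold (𝓡 m) ∞ M]

/-! ### Coordinates on the tangent bundle -/

/-! Fibrewise scaling is linear in the induced charts, and `Γ(X, y)` is linear in `y`. Hence its
differential keeps the horizontal part of a tangent vector and multiplies the vertical part by `r`
(`horPart_fibreScaleDeriv`, `vertPart_fibreScaleDeriv`), and the Sasaki metric pulls back to `g` on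
horizontal parts plus `r² g` on vertical parts. On the unit sphere bundle `t = 1/2`, so the first
vertical coefficient of `g_A` is `a(1/2) = r²`, and only the `b` term has to disappear. Metric
compatibility gives `d(g(u,u))(ξ) = 2 g(Kξ, u)` (`mfderiv_normSq_apply`): vectors tangent to the
sphere bundle are those whose vertical part is orthogonal to `u`, which kills the `b` term. Most of
the work lies in this formula, since compatibility has to be extracted from the coordinate
definition of `Γ` (`two_mul_inner_christoffelMap`). -/

/-- Bridge between the coordinate frame, which defines `metricCoeff`, and the bundle trivialization,
which defines the charts of `T(M)`. -/
theorem coordVec_eq_symmL (p : M) (i : Fin m) {y : EuclideanSpace ℝ (Fin m)}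
    (hy : y ∈ (extChartAt (𝓡 m) p).target) :
    coordVec p i y =
      (trivializationAt (EuclideanSpace ℝ (Fin m)) (TangentSpace (𝓡 m)) p).symmL ℝ
        ((extChartAt (𝓡 m) p).symm y) (EuclideanSpace.single i (1 : ℝ)) := by
  have h : (extChartAt (𝓡 m) p).symm y ∈ (chartAt (EuclideanSpace ℝ (Fin m)) p).source := by
    rw [← extChartAt_source (𝓡 m)]
    exact (extChartAt (𝓡 m) p).map_target hy
  rw [TangentBundle.symmL_trivializationAt h, (extChartAt (𝓡 m) p).right_inv hy]
  have hr : Set.range (𝓡 m) = Set.univ := (𝓡 m).range_eq_univ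
  rw [hr, mfderivWithin_univ]
  rfl

theorem symmL_trivializationAt_self (p : M) (v : EuclideanSpace ℝ (Fin m)) :
    (trivializationAt (EuclideanSpace ℝ (Fin m)) (TangentSpace (𝓡 m)) p).symmL ℝ p v = v := by
  rw [TangentBundle.symmL_trivializationAt_eq_core (mem_chart_source _ p)]
  exact (tangentBundleCore (𝓡 m) M).coordChange_self _ _ (mem_achart_source _ p) v

theorem extChartAt_tangent_symm (u : TM m M) {y : EuclideanSpace ℝ (Fin m)}
    (hy : y ∈ (extChartAt (𝓡 m) u.proj).target) (v : EuclideanSpace ℝ (Fin m)) :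
    (extChartAt (𝓡 m).tangent u).symm (y, v) =
      ⟨(extChartAt (𝓡 m) u.proj).symm y,
        (trivializationAt (EuclideanSpace ℝ (Fin m)) (TangentSpace (𝓡 m)) u.proj).symmL ℝ
          ((extChartAt (𝓡 m) u.proj).symm y) v⟩ := by
  have h : (extChartAt (𝓡 m) u.proj).symm y ∈
      (trivializationAt (EuclideanSpace ℝ (Fin m)) (TangentSpace (𝓡 m)) u.proj).baseSet := by
    rw [TangentBundle.trivializationAt_baseSet, ← extChartAt_source (𝓡 m)]
    exact (extChartAt (𝓡 m) u.proj).map_target hy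
  have := Bundle.Trivialization.mk_symm _ h v
  rw [FiberBundle.extChartAt]
  exact this.symm.trans (congrArg (TotalSpace.mk _)
    (Trivialization.symmL_apply (R := ℝ) _ h v).symm)

theorem extChartAt_tangent_self (u : TM m M) :
    extChartAt (𝓡 m).tangent u u = (extChartAt (𝓡 m) u.proj u.proj, u.snd) := by
  rw [FiberBundle.extChartAt]
  refine Prod.ext rfl ?_
  exact (tangentBundleCore (𝓡 m) M).coordChange_self _ _ (mem_achart_source _ u.proj) u.snd

theorem eventually_mem_extChartAt_target (u : TM m M) :
    ∀ᶠ z : EuclideanSpace ℝ (Fin m) × EuclideanSpace ℝ (Fin m) in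
      𝓝 (extChartAt (𝓡 m) u.proj u.proj, u.snd), z.1 ∈ (extChartAt (𝓡 m) u.proj).target :=
  continuousAt_fst.eventually
    (extChartAt_target_mem_nhds (I := 𝓡 m) u.proj : ∀ᶠ y in 𝓝 (extChartAt (𝓡 m) u.proj u.proj),
      y ∈ (extChartAt (𝓡 m) u.proj).target)

/-! ### Fibrewise scaling -/

theorem contMDiff_fibreScale (r : ℝ) :
    ContMDiff (𝓡 m).tangent (𝓡 m).tangent ∞ (fibreScale r : TM m M → TM m M) := by
  intro u
  have h0 : ContMDiffAt (𝓡 m).tangent (𝓡 m).tangent ∞ (id : TM m M → TM m M) u := contMDiffAt_id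
  rw [contMDiffAt_totalSpace] at h0 ⊢
  refine ⟨h0.1, ?_⟩
  have h1 : ContMDiffAt (𝓡 m).tangent 𝓘(ℝ, EuclideanSpace ℝ (Fin m)) ∞
      (fun x : TM m M => r • (trivializationAt (EuclideanSpace ℝ (Fin m)) (TangentSpace (𝓡 m))
        u.proj x).2) u :=
    ContMDiffAt.comp u (contDiff_const_smul r).contMDiff.contMDiffAt h0.2
  refine h1.congr_of_eventuallyEq ?_
  filter_upwards with x
  exact ((tangentBundleCore (𝓡 m) M).coordChange _ _ _).map_smul r x.snd

/-- Scaling preserves base points, so both sides use the same chart of `M`, and coordinate changes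
of the fibre commute with scalars. -/
theorem extChartAt_fibreScale (r : ℝ) (u x : TM m M) :
    extChartAt (𝓡 m).tangent (fibreScale r u) (fibreScale r x) =
      ((extChartAt (𝓡 m).tangent u x).1, r • (extChartAt (𝓡 m).tangent u x).2) := by
  rw [FiberBundle.extChartAt, FiberBundle.extChartAt]
  refine Prod.ext rfl ?_
  exact ((tangentBundleCore (𝓡 m) M).coordChange _ _ _).map_smul r x.snd

theorem hasMFDerivAt_fibreScale (r : ℝ) (u : TM m M) :
    HasMFDerivAt (𝓡 m).tangent (𝓡 m).tangent (fibreScale r) u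
      ((ContinuousLinearMap.fst ℝ (EuclideanSpace ℝ (Fin m)) (EuclideanSpace ℝ (Fin m))).prod
        (r • ContinuousLinearMap.snd ℝ (EuclideanSpace ℝ (Fin m)) (EuclideanSpace ℝ (Fin m)))) := by
  refine ⟨(contMDiff_fibreScale r).continuous.continuousAt, HasFDerivAt.hasFDerivWithinAt ?_⟩
  refine (ContinuousLinearMap.hasFDerivAt _).congr_of_eventuallyEq ?_
  filter_upwards [extChartAt_target_mem_nhds (I := (𝓡 m).tangent) u] with z hz
  simp only [writtenInExtChartAt, Function.comp_apply]
  rw [extChartAt_fibreScale, (extChartAt (𝓡 m).tangent u).right_inv hz]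
  rfl

/-! ### Regularity of the metric -/

/-- The base map `f` is arbitrary so that this covers both the tautological section over `T(M)` (for
`normSq`) and local frames over `M` (for `metricCoeff`). -/
theorem contMDiffAt_inner (g : Metric m M) {N : Type*} {EN : Type*} [NormedAddCommGroup EN]
    [NormedSpace ℝ EN] {HN : Type*} [TopologicalSpace HN] {J : ModelWithCorners ℝ EN HN}
    [TopologicalSpace N] [ChartedSpace HN N] {f : N → M} {v w : ∀ x, TangentSpace (𝓡 m) (f x)}
    {x : N}
    (hv : ContMDiffAt J (𝓡 m).tangent ∞ (fun y => (⟨f y, v y⟩ : TM m M)) x)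
    (hw : ContMDiffAt J (𝓡 m).tangent ∞ (fun y => (⟨f y, w y⟩ : TM m M)) x) :
    ContMDiffAt J 𝓘(ℝ, ℝ) ∞ (fun y => g.inner (f y) (v y) (w y)) x := by
  have hf : ContMDiffAt J (𝓡 m) ∞ f x := (contMDiffAt_totalSpace.1 hv).1
  have h : ContMDiffAt J ((𝓡 m).prod 𝓘(ℝ, ℝ)) ∞
      (fun y => TotalSpace.mk' ℝ (E := Bundle.Trivial M ℝ) (f y) (g.inner (f y) (v y) (w y))) x := by
    apply ContMDiffAt.clm_bundle_apply₂ (F₁ := EuclideanSpace ℝ (Fin m))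
      (F₂ := EuclideanSpace ℝ (Fin m))
    · exact ContMDiffAt.comp x g.contMDiff.contMDiffAt hf
    · exact hv
    · exact hw
  exact (contMDiffAt_totalSpace.1 h).2

theorem contMDiff_normSq (g : Metric m M) :
    ContMDiff (𝓡 m).tangent 𝓘(ℝ, ℝ) ∞ (normSq g) :=
  fun u => contMDiffAt_inner g (f := fun u : TM m M => u.proj) (v := fun u => u.snd)
    (w := fun u => u.snd) (x := u) contMDiffAt_id contMDiffAt_id

theorem differentiableAt_metricCoeff (g : Metric m M) (p : M) (i j : Fin m) :
    DifferentiableAt ℝ (metricCoeff g p i j) (extChartAt (𝓡 m) p p) := by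
  set e := trivializationAt (EuclideanSpace ℝ (Fin m)) (TangentSpace (𝓡 m) (M := M)) p with he
  have hs : ∀ v : EuclideanSpace ℝ (Fin m), ContMDiffAt (𝓡 m) (𝓡 m).tangent ∞
      (fun q => (⟨q, e.symmL ℝ q v⟩ : TM m M)) p := fun v =>
    ContMDiffAt.clm_bundle_apply (E₁ := Bundle.Trivial M (EuclideanSpace ℝ (Fin m)))
      (b := fun q : M => q)
      (e.contMDiffAt_symmL (mem_baseSet_trivializationAt _ _ p))
      (contMDiffAt_section p |>.2 contMDiffAt_const)
  have h1 := contMDiffAt_inner g (f := fun q : M => q) (hs (EuclideanSpace.single i (1 : ℝ)))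
    (hs (EuclideanSpace.single j (1 : ℝ)))
  have h2 : ContMDiffAt 𝓘(ℝ, EuclideanSpace ℝ (Fin m)) (𝓡 m) ∞ (extChartAt (𝓡 m) p).symm
      (extChartAt (𝓡 m) p p) :=
    (contMDiffOn_extChartAt_symm p).contMDiffAt (extChartAt_target_mem_nhds p)
  have h3 := ContMDiffAt.comp_of_eq (x := extChartAt (𝓡 m) p p) h1 h2 (extChartAt_to_inv p)
  refine (h3.contDiffAt.differentiableAt (by simp)).congr_of_eventuallyEq ?_
  filter_upwards [extChartAt_target_mem_nhds (I := 𝓡 m) p] with y hy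
  simp only [metricCoeff, coordVec_eq_symmL p _ hy, Function.comp_apply, he]

theorem metricMatrix_apply (g : Metric m M) (p : M) (i j : Fin m) :
    metricMatrix g p i j =
      g.inner p (EuclideanSpace.single i (1 : ℝ)) (EuclideanSpace.single j (1 : ℝ)) := by
  simp only [metricMatrix, Matrix.of_apply, metricCoeff,
    coordVec_eq_symmL p _ (mem_extChartAt_target p)]
  rw [extChartAt_to_inv p, symmL_trivializationAt_self, symmL_trivializationAt_self]

/-! ### Metric compatibility -/

theorem metricMatrix_comm (g : Metric m M) (p : M) (i j : Fin m) :
    metricMatrix g p i j = metricMatrix g p j i := g.symm _ _ _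

theorem eq_sum_smul_single (X : EuclideanSpace ℝ (Fin m)) :
    X = ∑ i, X i • EuclideanSpace.single i (1 : ℝ) := by
  ext k
  simp [Pi.single_apply]

/-- The map `S` is the identity when expanding `g` at the centre of the chart, and the inverse
trivialization at nearby points. -/
theorem bilinear_apply_eq_sum {V : Type*} [AddCommGroup V] [Module ℝ V] [TopologicalSpace V]
    [IsTopologicalAddGroup V] [ContinuousSMul ℝ V]
    (B : V →L[ℝ] V →L[ℝ] ℝ) (S : EuclideanSpace ℝ (Fin m) →L[ℝ] V)
    (X Y : EuclideanSpace ℝ (Fin m)) :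
    B (S X) (S Y) = ∑ i, ∑ j, B (S (EuclideanSpace.single i (1 : ℝ)))
      (S (EuclideanSpace.single j (1 : ℝ))) * X i * Y j := by
  conv_lhs => rw [eq_sum_smul_single X, eq_sum_smul_single Y]
  simp only [map_sum, map_smul, sum_apply, smul_apply, smul_eq_mul, Finset.mul_sum]
  rw [Finset.sum_comm]
  exact Finset.sum_congr rfl fun i _ => Finset.sum_congr rfl fun j _ => by ring

theorem inner_eq_sum (g : Metric m M) (p : M) (X Y : EuclideanSpace ℝ (Fin m)) :
    g.inner p X Y = ∑ i, ∑ j, metricMatrix g p i j * X i * Y j := by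
  simp only [metricMatrix_apply]
  exact bilinear_apply_eq_sum (g.inner p) (.id ℝ (TangentSpace (𝓡 m) p)) X Y

theorem isUnit_det_metricMatrix (g : Metric m M) (p : M) : IsUnit (metricMatrix g p).det := by
  rw [isUnit_iff_ne_zero]
  intro h
  -- A kernel vector `v` would satisfy `g(v, v) = 0`, against positivity.
  obtain ⟨v, hv, hv0⟩ := Matrix.exists_mulVec_eq_zero_iff.2 h
  have hne : (WithLp.toLp 2 v : EuclideanSpace ℝ (Fin m)) ≠ 0 := by
    intro h
    exact hv (by simpa using h)
  have hpos := g.pos p (WithLp.toLp 2 v : EuclideanSpace ℝ (Fin m)) hne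
  rw [inner_eq_sum g p] at hpos
  refine hpos.ne' (Finset.sum_eq_zero fun i _ => ?_)
  have := congrFun hv0 i
  simp only [Matrix.mulVec, dotProduct, Pi.zero_apply] at this
  calc _ = v i * ∑ j, metricMatrix g p i j * v j := by
        rw [Finset.mul_sum]
        exact Finset.sum_congr rfl fun j _ => by simp only; ring
    _ = 0 := by rw [this, mul_zero]

theorem sum_metricMatrix_mul_christoffel (g : Metric m M) (p : M) (l i j : Fin m) :
    ∑ k, metricMatrix g p l k * christoffel g p k i j =
      (1 / 2) * (partialMetricCoeff g p i j l + partialMetricCoeff g p j i l -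
        partialMetricCoeff g p l i j) := by
  have h : (metricMatrix g p) * (metricMatrix g p)⁻¹ = 1 :=
    Matrix.mul_nonsing_inv _ (isUnit_det_metricMatrix g p)
  set w : Fin m → ℝ := fun l => partialMetricCoeff g p i j l + partialMetricCoeff g p j i l -
    partialMetricCoeff g p l i j with hw
  have hc : (fun k => christoffel g p k i j) =
      (1 / 2 : ℝ) • (metricMatrix g p)⁻¹.mulVec w := by
    ext k
    simp [christoffel, Matrix.mulVec, dotProduct, hw]
  have h2 : (metricMatrix g p).mulVec (fun k => christoffel g p k i j) = (1 / 2 : ℝ) • w := by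
    rw [hc, Matrix.mulVec_smul, Matrix.mulVec_mulVec, h, Matrix.one_mulVec]
  exact congrFun h2 l

/-- The part of `∇g = 0` that is needed. Lowering the index of `Γ` leaves three derivatives of `g`;
against the symmetric `Yʲ Yˡ`, the terms `∂_j g_{il}` and `-∂_l g_{ij}` cancel. -/
theorem two_mul_inner_christoffelMap (g : Metric m M) (p : M) (X Y : EuclideanSpace ℝ (Fin m)) :
    2 * g.inner p (christoffelMap g p X Y) Y =
      ∑ i, ∑ j, ∑ l, partialMetricCoeff g p i j l * X i * Y j * Y l := by
  have h1 : g.inner p (christoffelMap g p X Y) Y =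
      ∑ i, ∑ j, ∑ l, (∑ k, metricMatrix g p l k * christoffel g p k i j) * X i * Y j * Y l := by
    rw [inner_eq_sum g p]
    simp only [christoffelMap, LinearMap.mk₂_apply, Finset.mul_sum, Finset.sum_mul]
    calc _ = ∑ l, ∑ k, ∑ i, ∑ j,
          metricMatrix g p l k * christoffel g p k i j * X i * Y j * Y l := by
          rw [Finset.sum_comm]
          refine Finset.sum_congr rfl fun l _ => Finset.sum_congr rfl fun k _ =>
            Finset.sum_congr rfl fun i _ => Finset.sum_congr rfl fun j _ => ?_
          rw [metricMatrix_comm g p k l]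
          ring
      _ = ∑ l, ∑ i, ∑ j, ∑ k,
          metricMatrix g p l k * christoffel g p k i j * X i * Y j * Y l := by
          refine Finset.sum_congr rfl fun l _ => ?_
          rw [Finset.sum_comm]
          exact Finset.sum_congr rfl fun i _ => Finset.sum_comm
      _ = _ := by
          rw [Finset.sum_comm]
          exact Finset.sum_congr rfl fun i _ => Finset.sum_comm
  rw [h1, Finset.mul_sum]
  refine Finset.sum_congr rfl fun i _ => ?_
  simp only [sum_metricMatrix_mul_christoffel]
  have h2 : ∑ j, ∑ l, partialMetricCoeff g p j i l * X i * Y j * Y l =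
      ∑ j, ∑ l, partialMetricCoeff g p l i j * X i * Y j * Y l := by
    rw [Finset.sum_comm]
    exact Finset.sum_congr rfl fun j _ => Finset.sum_congr rfl fun l _ => by ring
  have h3 : 2 * ∑ j, ∑ l, 1 / 2 * (partialMetricCoeff g p i j l + partialMetricCoeff g p j i l -
      partialMetricCoeff g p l i j) * X i * Y j * Y l =
      ∑ j, ∑ l, partialMetricCoeff g p i j l * X i * Y j * Y l +
        (∑ j, ∑ l, partialMetricCoeff g p j i l * X i * Y j * Y l -
          ∑ j, ∑ l, partialMetricCoeff g p l i j * X i * Y j * Y l) := by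
    simp only [Finset.mul_sum, ← Finset.sum_sub_distrib, ← Finset.sum_add_distrib]
    exact Finset.sum_congr rfl fun j _ => Finset.sum_congr rfl fun l _ => by ring
  rw [h3, h2, sub_self, add_zero]

/-! ### The differential of the norm -/

theorem normSq_symmL_eq_sum (g : Metric m M) (p : M) {y : EuclideanSpace ℝ (Fin m)}
    (hy : y ∈ (extChartAt (𝓡 m) p).target) (v : EuclideanSpace ℝ (Fin m)) :
    normSq g (⟨(extChartAt (𝓡 m) p).symm y,
        (trivializationAt (EuclideanSpace ℝ (Fin m)) (TangentSpace (𝓡 m)) p).symmL ℝ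
          ((extChartAt (𝓡 m) p).symm y) v⟩ : TM m M) =
      ∑ i, ∑ j, metricCoeff g p i j y * v i * v j := by
  simp only [normSq, metricCoeff, coordVec_eq_symmL p _ hy]
  exact bilinear_apply_eq_sum (g.inner ((extChartAt (𝓡 m) p).symm y)) _ v v

/-- Product rule for `g_{ij}(x) yⁱ yʲ`: the fibre factors give `2 g(ξ.2, v)`, and the coefficients
give the sum computed in `two_mul_inner_christoffelMap`. -/
theorem exists_hasFDerivAt_sum_metricCoeff (g : Metric m M) (p : M)
    (v : EuclideanSpace ℝ (Fin m)) :
    ∃ D : EuclideanSpace ℝ (Fin m) × EuclideanSpace ℝ (Fin m) →L[ℝ] ℝ,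
      HasFDerivAt (fun z : EuclideanSpace ℝ (Fin m) × EuclideanSpace ℝ (Fin m) =>
        ∑ i, ∑ j, metricCoeff g p i j z.1 * z.2 i * z.2 j) D (extChartAt (𝓡 m) p p, v) ∧
      ∀ ξ, D ξ = 2 * (g.inner p ξ.2 v + g.inner p (christoffelMap g p ξ.1 v) v) := by
  set x₀ := extChartAt (𝓡 m) p p with hx₀
  have hcoord : ∀ i, HasFDerivAt (fun z : EuclideanSpace ℝ (Fin m) × EuclideanSpace ℝ (Fin m) =>
      z.2 i) ((EuclideanSpace.proj i : EuclideanSpace ℝ (Fin m) →L[ℝ] ℝ).comp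
        (ContinuousLinearMap.snd ℝ _ _)) (x₀, v) := fun i =>
    ((EuclideanSpace.proj i : EuclideanSpace ℝ (Fin m) →L[ℝ] ℝ).comp
      (ContinuousLinearMap.snd ℝ (EuclideanSpace ℝ (Fin m)) _)).hasFDerivAt
  have hmetric : ∀ i j, HasFDerivAt
      (fun z : EuclideanSpace ℝ (Fin m) × EuclideanSpace ℝ (Fin m) => metricCoeff g p i j z.1)
      ((fderiv ℝ (metricCoeff g p i j) x₀).comp (ContinuousLinearMap.fst ℝ _ _)) (x₀, v) :=
    fun i j => HasFDerivAt.comp (g := metricCoeff g p i j) (f := Prod.fst) (x₀, v)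
      (differentiableAt_metricCoeff g p i j).hasFDerivAt hasFDerivAt_fst
  refine ⟨_, HasFDerivAt.fun_sum (u := Finset.univ) fun i _ => HasFDerivAt.fun_sum
    (u := Finset.univ) fun j _ => ((hmetric i j).mul (hcoord i)).mul (hcoord j), fun ξ => ?_⟩
  have hf : ∀ i j, fderiv ℝ (metricCoeff g p i j) x₀ ξ.1 =
      ∑ l, partialMetricCoeff g p l i j * ξ.1 l := by
    intro i j
    conv_lhs => rw [eq_sum_smul_single ξ.1]
    simp only [map_sum, map_smul, smul_eq_mul]
    exact Finset.sum_congr rfl fun l _ => mul_comm _ _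
  have hm : ∀ i j, metricCoeff g p i j x₀ = metricMatrix g p i j := fun i j => rfl
  rw [mul_add, two_mul_inner_christoffelMap, inner_eq_sum g p]
  have hswap : ∑ i, ∑ j, metricMatrix g p i j * v i * ξ.2 j =
      ∑ i, ∑ j, metricMatrix g p i j * ξ.2 i * v j := by
    rw [Finset.sum_comm]
    refine Finset.sum_congr rfl fun i _ => Finset.sum_congr rfl fun j _ => ?_
    rw [metricMatrix_comm g p j i]
    ring
  have hpart : ∑ i, ∑ j, ∑ l, partialMetricCoeff g p i j l * ξ.1 i * v j * v l =
      ∑ i, ∑ j, (∑ l, partialMetricCoeff g p l i j * ξ.1 l) * v i * v j := by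
    simp only [Finset.sum_mul]
    rw [Finset.sum_comm]
    exact Finset.sum_congr rfl fun j _ => Finset.sum_comm
  rw [hpart, two_mul]
  -- The product rule differentiates each fibre factor separately, so one of the two equal sums is
  -- transposed to match term by term.
  nth_rewrite 1 [← hswap]
  simp only [sum_apply, add_apply, smul_apply, ContinuousLinearMap.comp_apply,
    ContinuousLinearMap.coe_fst', ContinuousLinearMap.coe_snd', PiLp.proj_apply, Pi.mul_apply,
    smul_eq_mul, hf, hm, ← Finset.sum_add_distrib]
  exact Finset.sum_congr rfl fun i _ => Finset.sum_congr rfl fun j _ => by ring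

theorem mfderiv_normSq_apply (g : Metric m M) (u : TM m M)
    (ξ : TangentSpace (𝓡 m).tangent u) :
    mfderiv (𝓡 m).tangent 𝓘(ℝ, ℝ) (normSq g) u ξ =
      2 * g.inner u.proj (vertPart g u ξ) u.snd := by
  obtain ⟨D, hD, hDξ⟩ := exists_hasFDerivAt_sum_metricCoeff g u.proj u.snd
  have hd : HasMFDerivAt (𝓡 m).tangent 𝓘(ℝ, ℝ) (normSq g) u D := by
    refine ⟨(contMDiff_normSq g).continuous.continuousAt, HasFDerivAt.hasFDerivWithinAt ?_⟩
    rw [extChartAt_tangent_self]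
    refine hD.congr_of_eventuallyEq ?_
    filter_upwards [eventually_mem_extChartAt_target u] with z hz
    simp only [writtenInExtChartAt, Function.comp_apply]
    rw [extChartAt_tangent_symm _ hz]
    exact normSq_symmL_eq_sum g u.proj hz z.2
  rw [hd.mfderiv]
  -- Reading the form on `ℝᵐ` lets additivity merge the two terms into `ηᵏ + Γᵏ_{ij} ξⁱ yʲ`, the
  -- connection map.
  let B : EuclideanSpace ℝ (Fin m) →L[ℝ] EuclideanSpace ℝ (Fin m) →L[ℝ] ℝ := g.inner u.proj
  have hB : ∀ Y Z w, B (Y + Z) w = B Y w + B Z w := by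
    intro Y Z w
    rw [map_add, add_apply]
  refine (hDξ ξ).trans ?_
  exact congrArg (2 * ·) (hB _ _ _).symm

/-! ### Scaling of the unit tangent sphere bundle -/

theorem normSq_fibreScale (g : Metric m M) (r : ℝ) (u : TM m M) :
    normSq g (fibreScale r u) = r ^ 2 * normSq g u := by
  have h : ∀ B : TangentSpace (𝓡 m) u.proj →L[ℝ] TangentSpace (𝓡 m) u.proj →L[ℝ] ℝ,
      B (r • u.snd) (r • u.snd) = r ^ 2 * B u.snd u.snd := by
    intro B
    simp only [map_smul, smul_apply, smul_eq_mul]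
    ring
  exact h _

theorem fibreScale_fibreScale (r s : ℝ) (u : TM m M) :
    fibreScale r (fibreScale s u) = fibreScale (r * s) u :=
  congrArg (TotalSpace.mk u.proj) (smul_smul r s u.snd)

theorem fibreScale_one (u : TM m M) : fibreScale 1 u = u :=
  congrArg (TotalSpace.mk u.proj) (one_smul ℝ u.snd)

/-- Fibrewise scaling by `r ≠ 0`, as a bijection of the unit tangent sphere bundle onto `T_rM`. -/
noncomputable def sphereScale (g : Metric m M) {r : ℝ} (hr : r ≠ 0) :
    sphereBundle g 1 ≃ sphereBundle g r where
  toFun u := ⟨fibreScale r u, by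
    have hu : normSq g u = 1 ^ 2 := u.2
    change normSq g _ = r ^ 2
    rw [normSq_fibreScale, hu, one_pow, mul_one]⟩
  invFun v := ⟨fibreScale r⁻¹ v, by
    have hv : normSq g v = r ^ 2 := v.2
    change normSq g _ = 1 ^ 2
    rw [normSq_fibreScale, hv]
    field_simp⟩
  left_inv u := Subtype.ext <| by
    change fibreScale r⁻¹ (fibreScale r (u : TM m M)) = u
    rw [fibreScale_fibreScale, inv_mul_cancel₀ hr, fibreScale_one]
  right_inv v := Subtype.ext <| by
    change fibreScale r (fibreScale r⁻¹ (v : TM m M)) = v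
    rw [fibreScale_fibreScale, mul_inv_cancel₀ hr, fibreScale_one]

/-- Scaling is smooth on all of `T(M)`, so one global extension serves at every point, for `r` and
for `r⁻¹`. -/
theorem isLocalExtension_fibreScale (r : ℝ) (S : Set (TM m M)) (x : S) :
    IsLocalExtension S (fun u => fibreScale r u) x (fibreScale r) :=
  ⟨Set.univ, isOpen_univ, Set.mem_univ _, (contMDiff_fibreScale r).contMDiffOn, fun _ _ => rfl⟩

/-- The differential of fibrewise scaling. -/
noncomputable def fibreScaleDeriv (r : ℝ) (u : TM m M) :
    TangentSpace (𝓡 m).tangent u →ₗ[ℝ] TangentSpace (𝓡 m).tangent (fibreScale r u) :=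
  (mfderiv (𝓡 m).tangent (𝓡 m).tangent (fibreScale r) u).toLinearMap

theorem fibreScaleDeriv_apply (r : ℝ) (u : TM m M)
    (ξ : EuclideanSpace ℝ (Fin m) × EuclideanSpace ℝ (Fin m)) :
    fibreScaleDeriv r u ξ =
      ((ξ.1, r • ξ.2) : EuclideanSpace ℝ (Fin m) × EuclideanSpace ℝ (Fin m)) := by
  rw [fibreScaleDeriv, (hasMFDerivAt_fibreScale r u).mfderiv]
  rfl

theorem horPart_fibreScaleDeriv (r : ℝ) (u : TM m M) (ξ : TangentSpace (𝓡 m).tangent u) :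
    horPart (fibreScale r u) (fibreScaleDeriv r u ξ) = horPart u ξ := by
  have h := congrArg (horPart (fibreScale r u)) (fibreScaleDeriv_apply r u ξ)
  exact h

theorem vertPart_fibreScaleDeriv (g : Metric m M) (r : ℝ) (u : TM m M)
    (ξ : TangentSpace (𝓡 m).tangent u) :
    vertPart g (fibreScale r u) (fibreScaleDeriv r u ξ) = r • vertPart g u ξ := by
  have h : ∀ (ζ : EuclideanSpace ℝ (Fin m) × EuclideanSpace ℝ (Fin m))
      (v : EuclideanSpace ℝ (Fin m)),
      r • ζ.2 + christoffelMap g u.proj ζ.1 (r • v) =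
        r • (ζ.2 + christoffelMap g u.proj ζ.1 v) := by
    intro ζ v
    rw [map_smul, smul_add]
  exact (congrArg (vertPart g (fibreScale r u)) (fibreScaleDeriv_apply r u ξ)).trans (h ξ u.snd)

theorem mem_sphereTangent_iff (g : Metric m M) (r : ℝ) (v : sphereBundle g r)
    (ξ : TangentSpace (𝓡 m).tangent (v : TM m M)) :
    ξ ∈ sphereTangent g r v ↔
      g.inner (v : TM m M).proj (vertPart g v ξ) (v : TM m M).snd = 0 := by
  rw [sphereTangent, LinearMap.mem_ker]
  change mfderiv (𝓡 m).tangent 𝓘(ℝ, ℝ) (normSq g) (v : TM m M) ξ = 0 ↔ _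
  rw [mfderiv_normSq_apply]
  exact mul_eq_zero_iff_left (two_ne_zero (α := ℝ))

theorem fibreScaleDeriv_mem_sphereTangent (g : Metric m M) {r : ℝ} (hr : r ≠ 0)
    (u : sphereBundle g 1) (ξ : sphereTangent g 1 u) :
    fibreScaleDeriv r u (ξ : TangentSpace (𝓡 m).tangent (u : TM m M)) ∈
      sphereTangent g r (sphereScale g hr u) := by
  have hξ := (mem_sphereTangent_iff g 1 u ξ).1 ξ.2
  refine (mem_sphereTangent_iff g r (sphereScale g hr u) _).2 ?_
  have h : ∀ (B : TangentSpace (𝓡 m) (u : TM m M).proj →L[ℝ]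
      TangentSpace (𝓡 m) (u : TM m M).proj →L[ℝ] ℝ) X Y, B X Y = 0 → B (r • X) (r • Y) = 0 := by
    intro B X Y hXY
    simp only [map_smul, smul_apply, hXY, smul_zero]
  change g.inner (u : TM m M).proj (vertPart g (fibreScale r (u : TM m M)) _) (r • _) = 0
  rw [vertPart_fibreScaleDeriv]
  exact h _ _ _ hξ

/-- The differential of the scaling of the unit tangent sphere bundle. -/
noncomputable def sphereScaleDeriv (g : Metric m M) {r : ℝ} (hr : r ≠ 0) (u : sphereBundle g 1) :
    sphereTangent g 1 u →ₗ[ℝ] sphereTangent g r (sphereScale g hr u) :=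
  LinearMap.codRestrict (sphereTangent g r (sphereScale g hr u))
    ((fibreScaleDeriv r (u : TM m M)).domRestrict (sphereTangent g 1 u))
    (fibreScaleDeriv_mem_sphereTangent g hr u)

theorem metricS_fibreScaleDeriv (g : Metric m M) (r : ℝ) (u : TM m M)
    (ξ η : TangentSpace (𝓡 m).tangent u) :
    metricS g (fibreScale r u) (fibreScaleDeriv r u ξ) (fibreScaleDeriv r u η) =
      g.inner u.proj (horPart u ξ) (horPart u η) +
        r ^ 2 * g.inner u.proj (vertPart g u ξ) (vertPart g u η) := by
  simp only [metricS, metricA, LinearMap.mk₂_apply, horPart_fibreScaleDeriv,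
    vertPart_fibreScaleDeriv, zero_mul, add_zero, one_mul]
  have h : ∀ (B : TangentSpace (𝓡 m) u.proj →L[ℝ] TangentSpace (𝓡 m) u.proj →L[ℝ] ℝ) X Y,
      B (r • X) (r • Y) = r ^ 2 * B X Y := by
    intro B X Y
    simp only [map_smul, smul_apply, smul_eq_mul]
    ring
  exact congrArg _ (h (g.inner u.proj) _ _)

/-- Tangency makes the vertical part of `ξ` orthogonal to `u`, which removes `b`; unit length fixes
`t = 1/2`. -/
theorem inducedA_apply (g : Metric m M) (a b : ℝ → ℝ) (u : sphereBundle g 1)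
    (ξ η : sphereTangent g 1 u) :
    inducedA g a b 1 u ξ η =
      g.inner (u : TM m M).proj (horPart (u : TM m M) ξ) (horPart (u : TM m M) η) +
        a (1 / 2) * g.inner (u : TM m M).proj (vertPart g (u : TM m M) ξ)
          (vertPart g (u : TM m M) η) := by
  have hu : normSq g u = 1 := by
    have : normSq g u = 1 ^ 2 := u.2
    rw [this, one_pow]
  have hξ := (mem_sphereTangent_iff g 1 u ξ).1 ξ.2
  change metricA g a b u ξ η = _
  simp only [metricA, LinearMap.mk₂_apply, hξ, hu, zero_mul, mul_zero, add_zero]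

theorem inducedS_sphereScaleDeriv (g : Metric m M) (a b : ℝ → ℝ) {r : ℝ} (hr : r ≠ 0)
    (hra : r ^ 2 = a (1 / 2)) (u : sphereBundle g 1) (ξ η : sphereTangent g 1 u) :
    inducedS g r (sphereScale g hr u) (sphereScaleDeriv g hr u ξ) (sphereScaleDeriv g hr u η) =
      inducedA g a b 1 u ξ η := by
  rw [inducedA_apply, ← hra]
  exact metricS_fibreScaleDeriv g r u ξ η

theorem isIsometry_sphereScale (g : Metric m M) (a b : ℝ → ℝ) {r : ℝ} (hr : r ≠ 0)
    (hra : r ^ 2 = a (1 / 2)) :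
    IsIsometry g (inducedA g a b 1) (inducedS g r) (sphereScale g hr) where
  smooth u := ⟨_, isLocalExtension_fibreScale r _ u⟩
  smooth_symm v := ⟨_, isLocalExtension_fibreScale r⁻¹ _ v⟩
  isometry u := ⟨sphereScaleDeriv g hr u, ⟨_, isLocalExtension_fibreScale r _ u, fun _ => rfl⟩,
    inducedS_sphereScaleDeriv g a b hr hra u⟩

theorem IsIsometry.smul {g : Metric m M} {s r : ℝ}
    {G : ∀ u : sphereBundle g s, LinearMap.BilinForm ℝ (sphereTangent g s u)}
    {G' : ∀ v : sphereBundle g r, LinearMap.BilinForm ℝ (sphereTangent g r v)}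
    {F : sphereBundle g s ≃ sphereBundle g r} (h : IsIsometry g G G' F) (c : ℝ) :
    IsIsometry g (fun u => c • G u) (fun v => c • G' v) F where
  smooth := h.smooth
  smooth_symm := h.smooth_symm
  isometry u := by
    obtain ⟨L, hΦ, hL⟩ := h.isometry u
    refine ⟨L, hΦ, fun ξ η => ?_⟩
    simp only [LinearMap.smul_apply, hL]

end TangentSphere

theorem theorem3p3 {m : ℕ} {M : Type*} [TopologicalSpace M]
    [ChartedSpace (EuclideanSpace ℝ (Fin m)) M] [IsManifold (𝓡 m) ∞ M]
    (g : TangentSphere.Metric m M) (a b : ℝ → ℝ)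
    (ha : ∀ t, 0 ≤ t → 0 < a t) (hab : ∀ t, 0 ≤ t → 0 < a t + 2 * t * b t)
    (r : ℝ) (hr : r = Real.sqrt (a (1 / 2))) :
    ∃ F : TangentSphere.sphereBundle g 1 ≃ TangentSphere.sphereBundle g r,
      (∀ u, (F u : TangentSphere.TM m M) = TangentSphere.fibreScale r u) ∧
      TangentSphere.IsIsometry g (TangentSphere.inducedA g a b 1) (TangentSphere.inducedS g r) F ∧
      TangentSphere.IsIsometry g
        (fun u => (1 / (4 * a (1 / 2))) • TangentSphere.inducedA g a b 1 u)
        (fun v => (1 / (4 * r ^ 2)) • TangentSphere.inducedS g r v) F := by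
  have ha' : 0 < a (1 / 2) := ha _ (by norm_num)
  have hr0 : r ≠ 0 := hr ▸ (Real.sqrt_pos.2 ha').ne'
  have hra : r ^ 2 = a (1 / 2) := by rw [hr, Real.sq_sqrt ha'.le]
  have h := TangentSphere.isIsometry_sphereScale g a b hr0 hra
  refine ⟨TangentSphere.sphereScale g hr0, fun _ => rfl, h, ?_⟩
  -- Both rescaling constants become `1 / (4 * a (1 / 2))`, and a common factor preserves
  -- isometries.
  rw [hra]
  exact h.smul _
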